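/- Let $(M,g)$ be a smooth $n$-dimensional Riemannian manifold with Levi-Civita connection $\nabla$. Let $\pi:L(M)\to M$ be its frame bundle, whose points over $x$ are the bases $u=(u_1,\dots,u_n)$ of $T_xM$, equivalently the linear isomorphisms $u:\mathbb{R}^n\to T_xM$ with $u e_k=u_k$. Let $\omega$ be the $\mathfrak{gl}(n)$-valued connection form of $\nabla$ on $L(M)$, and for $u\in L(M)$ put $H^{L(M)}_u=\ker\omega_u$ and $V^{L(M)}_u=\ker \pi_{*u}$. Let $\pi_{TM}:TM\to M$ be the tangent bundle, $K:TTM\to TM$ the connection map of $\nabla$ (the fibrewise linear map determined by $K(\sigma_*v)=\nabla_v\sigma$ for local vector fields $\sigma$), and for $\zeta\in TM$ put $H^{TM}_\zeta=\ker K|_{T_\zeta TM}$ and $V^{TM}_\zeta=\ker (\pi_{TM})_{*\zeta}$. For a vector field $X$ on $M$ let $X^h$ (resp. $X^{h,TM}$) be its horizontal lift to $L(M)$ (resp. $TM$): the unique section of $H^{L(M)}$ (resp. $H^{TM}$) projecting to $X$. For $\xi\in\mathbb{R}^n$ let $R_\xi:L(M)\to TM$, $R_\xi(u)=u\xi$,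 and let $R_i=R_{e_i}$, i.e. $R_i(u)=u_i$. For $A\in\mathfrak{gl}(n)$ let $A^*_u=\frac{d}{dt}\big|_{t=0}u\exp(tA)$ be the fundamental vector of $A$, and let $V^i_u\subset T_uL(M)$ be the span of the vectors $A^*_u$ over all matrices $A$ whose columns other than the $i$-th one vanish. Then the following hold. (1) For every $\xi\in\mathbb{R}^n$, every vector field $X$ on $M$ and every $u\in L(M)$, $(R_\xi)_{*}X^h_u=X^{h,TM}_{R_\xi(u)}$. Moreover, for every $i$ and every $u\in L(M)$ the map $R_{i*}$ restricts to an isomorphism $H^{L(M)}_u\to H^{TM}_{R_i(u)}$. (2) For every $i$ and every $u\in L(M)$ the map $R_{i*}$ restricts to an isomorphism $V^i_u\to V^{TM}_{R_i(u)}$, and it vanishes on $V^j_u$ for $j\neq i$. Moreover, $V^{L(M)}_u=V^1_u\oplus\dots\oplus V^n_u$. -/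

import Mathlib

open Bundle Manifold
open scoped ContDiff Topology

noncomputable section

namespace FrameBundleGeometry

/-! ### Derivatives in total spaces of bundles and in open submanifolds -/

section Gen
variable {E F H B EN HN N : Type*} [NormedAddCommGroup E] [NormedSpace ℝ E] [NormedAddCommGroup F]
  [NormedSpace ℝ F] [TopologicalSpace H] {I : ModelWithCorners ℝ E H} [TopologicalSpace B]
  [ChartedSpace H B] {V : B → Type*} [TopologicalSpace (TotalSpace F V)]
  [∀ x, TopologicalSpace (V x)] [FiberBundle F V]
  [NormedAddCommGroup EN] [NormedSpace ℝ EN] [TopologicalSpace HN] {IN : ModelWithCorners ℝ EN HN}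
  [TopologicalSpace N] [ChartedSpace HN N]

theorem hasMFDerivAt_totalSpace {f : N → TotalSpace F V} {x₀ : N} {D₁ : EN →L[ℝ] E}
    {D₂ : EN →L[ℝ] F}
    (h₁ : HasMFDerivAt IN I (fun x => (f x).proj) x₀ D₁)
    (h₂ : HasMFDerivAt IN 𝓘(ℝ, F) (fun x => (trivializationAt F V (f x₀).proj (f x)).2) x₀ D₂) :
    HasMFDerivAt IN (I.prod 𝓘(ℝ, F)) f x₀ (D₁.prod D₂) := by
  refine ⟨(FiberBundle.continuousAt_totalSpace F f).2 ⟨h₁.1, h₂.1⟩, ?_⟩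
  refine (h₁.2.prodMk h₂.2).congr_of_eventuallyEq ?_ ?_
  · have hb : ∀ᶠ x in 𝓝 x₀, (f x).proj ∈ (trivializationAt F V (f x₀).proj).baseSet :=
      h₁.1.eventually ((trivializationAt F V (f x₀).proj).open_baseSet.mem_nhds
        (FiberBundle.mem_baseSet_trivializationAt' _))
    have ht : Filter.Tendsto (extChartAt IN x₀).symm (𝓝[Set.range IN] (extChartAt IN x₀ x₀))
        (𝓝 x₀) := by
      have := (continuousAt_extChartAt_symm (I := IN) x₀).tendsto
      rw [extChartAt_to_inv] at this
      exact this.mono_left nhdsWithin_le_nhds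
    filter_upwards [ht.eventually hb] with y hy
    simp only [writtenInExtChartAt, FiberBundle.extChartAt, Function.comp_apply,
      PartialEquiv.trans_apply, PartialEquiv.prod_coe, PartialEquiv.refl_coe,
      OpenPartialHomeomorph.coe_toPartialEquiv, Trivialization.coe_coe, id]
    rw [Trivialization.coe_fst' _ hy]
    rfl
  · simp only [writtenInExtChartAt, FiberBundle.extChartAt, Function.comp_apply,
      PartialEquiv.trans_apply, PartialEquiv.prod_coe, PartialEquiv.refl_coe,
      OpenPartialHomeomorph.coe_toPartialEquiv, Trivialization.coe_coe, id, extChartAt_to_inv]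
    rw [Trivialization.coe_fst' _ (FiberBundle.mem_baseSet_trivializationAt' _)]
    rfl

theorem hasMFDerivAt_coords (z : TotalSpace F V) :
    HasMFDerivAt (I.prod 𝓘(ℝ, F)) I (TotalSpace.proj : TotalSpace F V → B) z
      (ContinuousLinearMap.fst ℝ E F) ∧
    HasMFDerivAt (I.prod 𝓘(ℝ, F)) 𝓘(ℝ, F)
      (fun w : TotalSpace F V => (trivializationAt F V z.proj w).2) z
      (ContinuousLinearMap.snd ℝ E F) := by
  have hz : z.proj ∈ (trivializationAt F V z.proj).baseSet :=
    FiberBundle.mem_baseSet_trivializationAt' _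
  have hc := (FiberBundle.continuousAt_totalSpace F (fun w : TotalSpace F V => w)).1
    (continuousAt_id (x := z))
  have ht := extChartAt_target_mem_nhdsWithin (I := I.prod 𝓘(ℝ, F)) z
  have key : ∀ y ∈ (extChartAt (I.prod 𝓘(ℝ, F)) z).target,
      extChartAt I z.proj ((extChartAt (I.prod 𝓘(ℝ, F)) z).symm y).proj = y.1 ∧
      (trivializationAt F V z.proj ((extChartAt (I.prod 𝓘(ℝ, F)) z).symm y)).2 = y.2 := by
    intro y hy
    have h1 := (extChartAt (I.prod 𝓘(ℝ, F)) z).right_inv hy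
    have h2 := (extChartAt (I.prod 𝓘(ℝ, F)) z).map_target hy
    generalize (extChartAt (I.prod 𝓘(ℝ, F)) z).symm y = w at h1 h2
    rw [extChartAt_source, FiberBundle.chartedSpace_chartAt] at h2
    have hw : w.proj ∈ (trivializationAt F V z.proj).baseSet :=
      (Trivialization.mem_source _).1 h2.1
    subst h1
    simp only [FiberBundle.extChartAt,
      PartialEquiv.trans_apply, PartialEquiv.prod_coe, PartialEquiv.refl_coe,
      OpenPartialHomeomorph.coe_toPartialEquiv, Trivialization.coe_coe, id]
    rw [Trivialization.coe_fst' _ hw]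
    exact ⟨rfl, trivial⟩
  refine ⟨⟨hc.1, ?_⟩, ⟨hc.2, ?_⟩⟩
  · refine HasFDerivWithinAt.congr_of_eventuallyEq
      (ContinuousLinearMap.fst ℝ E F).hasFDerivWithinAt ?_ ?_
    · filter_upwards [ht] with y hy using (key y hy).1
    · exact (key _ (mem_extChartAt_target z)).1
  · refine HasFDerivWithinAt.congr_of_eventuallyEq
      (ContinuousLinearMap.snd ℝ E F).hasFDerivWithinAt ?_ ?_
    · filter_upwards [ht] with y hy using (key y hy).2
    · exact (key _ (mem_extChartAt_target z)).2

theorem hasMFDerivAt_opens_iff {U : TopologicalSpace.Opens N} {f : B → U} {x : B}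
    {D : E →L[ℝ] EN} :
    HasMFDerivAt I IN (fun y => (f y : N)) x D ↔ HasMFDerivAt I IN f x D :=
  and_congr Topology.IsInducing.subtypeVal.continuousAt_iff.symm Iff.rfl

theorem hasMFDerivAt_opens_val {U : TopologicalSpace.Opens N} (u : U) :
    HasMFDerivAt IN IN (Subtype.val : U → N) u (ContinuousLinearMap.id ℝ EN) :=
  hasMFDerivAt_opens_iff.2 (hasMFDerivAt_id u)

end Gen

/-! ### The Levi-Civita connection -/

section LeviCivita
open VectorField FiberBundle

theorem completeSpace_tangentSpace {E : Type*} [NormedAddCommGroup E] [NormedSpace ℝ E]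
    [FiniteDimensional ℝ E] {H : Type*} [TopologicalSpace H] {I : ModelWithCorners ℝ E H}
    {M : Type*} [TopologicalSpace M] [ChartedSpace H M]
    [RiemannianBundle (fun x : M => TangentSpace I x)] (x : M) : CompleteSpace (TangentSpace I x) :=
  haveI : FiniteDimensional ℝ (TangentSpace I x) := inferInstanceAs (FiniteDimensional ℝ E)
  FiniteDimensional.complete ℝ (TangentSpace I x)

variable {E : Type*} [NormedAddCommGroup E] [NormedSpace ℝ E] [FiniteDimensional ℝ E]
  [CompleteSpace E]
  {H : Type*} [TopologicalSpace H] {I : ModelWithCorners ℝ E H}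
  {M : Type*} [TopologicalSpace M] [ChartedSpace H M] [IsManifold I ∞ M]
  [RiemannianBundle (fun x : M => TangentSpace I x)]
  [IsContMDiffRiemannianBundle I ∞ E (fun x : M => TangentSpace I x)]

/-- The right-hand side of the Koszul formula for `2 ⟨∇_X Y, Z⟩`. -/
def koszul (X Y Z : Π x : M, TangentSpace I x) (x : M) : ℝ :=
  d% (fun y => inner ℝ (Y y) (Z y)) x (X x) + d% (fun y => inner ℝ (X y) (Z y)) x (Y x)
    - d% (fun y => inner ℝ (X y) (Y y)) x (Z x)
    + inner ℝ (mlieBracket I X Y x) (Z x) - inner ℝ (mlieBracket I X Z x) (Y x)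
    - inner ℝ (mlieBracket I Y Z x) (X x)

variable {X Y Z X' Y' Z' : Π x : M, TangentSpace I x} {x : M}

theorem md_inner (hX : MDiffAt (T% X) x) (hY : MDiffAt (T% Y) x) :
    MDiffAt (fun y => inner ℝ (X y) (Y y)) x := by
  have : IsContMDiffRiemannianBundle I 1 E (fun x : M => TangentSpace I x) :=
    IsContMDiffRiemannianBundle.of_le (n := ∞) (by exact_mod_cast le_top)
  exact MDifferentiableAt.inner_bundle (b := fun y : M => y) (F := E)
    (E := fun x : M => TangentSpace I x) (IB := I) hX hY

theorem koszul_tensorial_left (hY : MDiffAt (T% Y) x) (hZ : MDiffAt (T% Z) x) :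
    TensorialAt I E (fun X => koszul X Y Z x) x where
  smul {f σ} hf hσ := by
    have e1 : (fun y => inner ℝ ((f • σ) y) (Z y)) = fun y => f y * inner ℝ (σ y) (Z y) := by
      ext y; simp [inner_smul_left]
    have e2 : (fun y => inner ℝ ((f • σ) y) (Y y)) = fun y => f y * inner ℝ (σ y) (Y y) := by
      ext y; simp [inner_smul_left]
    simp only [koszul, e1, e2]
    rw [mvfderiv_fun_mul hf (md_inner hσ hZ), mvfderiv_fun_mul hf (md_inner hσ hY),
      mlieBracket_smul_left hf hσ, mlieBracket_smul_left hf hσ]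
    simp [inner_add_left, inner_smul_left, inner_smul_right]
    ring
  add {σ σ'} hσ hσ' := by
    have e1 : (fun y => inner ℝ ((σ + σ') y) (Z y)) = fun y => inner ℝ (σ y) (Z y) + inner ℝ (σ' y) (Z y) := by
      ext y; simp [inner_add_left]
    have e2 : (fun y => inner ℝ ((σ + σ') y) (Y y)) = fun y => inner ℝ (σ y) (Y y) + inner ℝ (σ' y) (Y y) := by
      ext y; simp [inner_add_left]
    simp only [koszul, e1, e2]
    rw [mvfderiv_fun_add (md_inner hσ hZ) (md_inner hσ' hZ), mvfderiv_fun_add (md_inner hσ hY) (md_inner hσ' hY),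
      mlieBracket_add_left hσ hσ', mlieBracket_add_left hσ hσ']
    simp [inner_add_left, inner_add_right]
    ring

theorem koszul_tensorial_right (hX : MDiffAt (T% X) x) (hY : MDiffAt (T% Y) x) :
    TensorialAt I E (fun Z => koszul X Y Z x) x where
  smul {f σ} hf hσ := by
    have e1 : (fun y => inner ℝ (X y) ((f • σ) y)) = fun y => f y * inner ℝ (X y) (σ y) := by
      ext y; simp [inner_smul_right]
    have e2 : (fun y => inner ℝ (Y y) ((f • σ) y)) = fun y => f y * inner ℝ (Y y) (σ y) := by
      ext y; simp [inner_smul_right]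
    simp only [koszul, e1, e2]
    rw [mvfderiv_fun_mul hf (md_inner hX hσ), mvfderiv_fun_mul hf (md_inner hY hσ),
      mlieBracket_smul_right hf hσ, mlieBracket_smul_right hf hσ]
    simp [inner_add_left, inner_smul_left, inner_smul_right]
    rw [real_inner_comm (σ x) (X x), real_inner_comm (σ x) (Y x)]
    ring
  add {σ σ'} hσ hσ' := by
    have e1 : (fun y => inner ℝ (X y) ((σ + σ') y)) = fun y => inner ℝ (X y) (σ y) + inner ℝ (X y) (σ' y) := by
      ext y; simp [inner_add_right]
    have e2 : (fun y => inner ℝ (Y y) ((σ + σ') y)) = fun y => inner ℝ (Y y) (σ y) + inner ℝ (Y y) (σ' y) := by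
      ext y; simp [inner_add_right]
    simp only [koszul, e1, e2]
    rw [mvfderiv_fun_add (md_inner hX hσ) (md_inner hX hσ'), mvfderiv_fun_add (md_inner hY hσ) (md_inner hY hσ'),
      mlieBracket_add_right hσ hσ', mlieBracket_add_right hσ hσ']
    simp [inner_add_left, inner_add_right]
    ring

/-- The covariant derivative `X ↦ ∇_X Y` at `x` given by the Koszul formula
`⟨∇_X Y, Z⟩ = koszul X Y Z / 2` (and by `0` if `Y` is not differentiable at `x`). -/
def leviCivitaAux (Y : Π x : M, TangentSpace I x) (x : M) :
    TangentSpace I x →L[ℝ] TangentSpace I x :=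
  open scoped Classical in
  if hY : MDiffAt (T% Y) x then
    haveI : CompleteSpace (TangentSpace I x) := completeSpace_tangentSpace x
    (InnerProductSpace.toDual ℝ (TangentSpace I x)).symm.toContinuousLinearEquiv.toContinuousLinearMap ∘L
     ((1 / 2 : ℝ) • TensorialAt.mkHom₂ (F := E) (F' := E) (I := I) (fun X Z => koszul X Y Z x) x
      (fun _ hZ => koszul_tensorial_left hY hZ) (fun _ hX => koszul_tensorial_right hX hY))
  else 0

theorem inner_leviCivitaAux (hX : MDiffAt (T% X) x) (hY : MDiffAt (T% Y) x)
    (hZ : MDiffAt (T% Z) x) :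
    inner ℝ (leviCivitaAux Y x (X x)) (Z x) = (1 / 2 : ℝ) * koszul X Y Z x := by
  rw [leviCivitaAux, dif_pos hY]
  have : CompleteSpace (TangentSpace I x) := completeSpace_tangentSpace x
  simp only [ContinuousLinearMap.comp_apply, _root_.smul_apply, map_smul, inner_smul_left]
  congr 1
  refine (InnerProductSpace.toDual_symm_apply (𝕜 := ℝ) (E := TangentSpace I x)).trans ?_
  exact TensorialAt.mkHom₂_apply _ _ hX hZ

theorem koszul_add_mid (hX : MDiffAt (T% X) x) (hY : MDiffAt (T% Y) x) (hY' : MDiffAt (T% Y') x)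
    (hZ : MDiffAt (T% Z) x) : koszul X (Y + Y') Z x = koszul X Y Z x + koszul X Y' Z x := by
  have e1 : (fun y => inner ℝ ((Y + Y') y) (Z y)) =
      fun y => inner ℝ (Y y) (Z y) + inner ℝ (Y' y) (Z y) := by
    ext y; simp [inner_add_left]
  have e2 : (fun y => inner ℝ (X y) ((Y + Y') y)) =
      fun y => inner ℝ (X y) (Y y) + inner ℝ (X y) (Y' y) := by
    ext y; simp [inner_add_right]
  simp only [koszul, e1, e2]
  rw [mvfderiv_fun_add (md_inner hY hZ) (md_inner hY' hZ),
    mvfderiv_fun_add (md_inner hX hY) (md_inner hX hY'),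
    mlieBracket_add_left hY hY', mlieBracket_add_right hY hY']
  simp [inner_add_left, inner_add_right]
  ring

theorem koszul_smul_mid {f : M → ℝ} (hX : MDiffAt (T% X) x) (hY : MDiffAt (T% Y) x)
    (hf : MDiffAt f x) (hZ : MDiffAt (T% Z) x) :
    koszul X (f • Y) Z x = f x * koszul X Y Z x + 2 * (d% f x (X x) * inner ℝ (Y x) (Z x)) := by
  have e1 : (fun y => inner ℝ ((f • Y) y) (Z y)) = fun y => f y * inner ℝ (Y y) (Z y) := by
    ext y; simp [inner_smul_left]
  have e2 : (fun y => inner ℝ (X y) ((f • Y) y)) = fun y => f y * inner ℝ (X y) (Y y) := by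
    ext y; simp [inner_smul_right]
  simp only [koszul, e1, e2]
  rw [mvfderiv_fun_mul hf (md_inner hY hZ), mvfderiv_fun_mul hf (md_inner hX hY),
    mlieBracket_smul_left hf hY, mlieBracket_smul_right hf hY]
  simp [inner_add_left, inner_smul_left, inner_smul_right]
  rw [real_inner_comm (Y x) (X x)]
  ring

/-- Two endomorphisms of a tangent space agree if they agree against differentiable fields. -/
theorem ext_inner_fields {A B : TangentSpace I x →L[ℝ] TangentSpace I x}
    (h : ∀ X Z : Π x : M, TangentSpace I x, MDiffAt (T% X) x → MDiffAt (T% Z) x →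
      inner ℝ (A (X x)) (Z x) = inner ℝ (B (X x)) (Z x)) : A = B := by
  ext v
  refine ext_inner_right ℝ fun w => ?_
  simpa using h (extend E v) (extend E w) (mdifferentiableAt_extend ..)
    (mdifferentiableAt_extend ..)

variable (I M) in
/-- The Levi-Civita connection of the Riemannian metric on `M`, defined by the Koszul formula. It
is torsion-free and metric, see `torsion_leviCivita` and `mvfderiv_inner_leviCivita`. -/
def leviCivita : CovariantDerivative I E (TangentSpace I : M → Type _) where
  toFun := leviCivitaAux
  isCovariantDerivativeOnUniv :=
    { add := by
        intro Y Y' x hY hY' _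
        refine ext_inner_fields fun X Z hX hZ => ?_
        rw [inner_leviCivitaAux hX (mdifferentiableAt_add_section hY hY') hZ,
          koszul_add_mid hX hY hY' hZ, _root_.add_apply, inner_add_left,
          inner_leviCivitaAux hX hY hZ, inner_leviCivitaAux hX hY' hZ]
        ring
      leibniz := by
        intro Y f x hY hf _
        refine ext_inner_fields fun X Z hX hZ => ?_
        rw [inner_leviCivitaAux hX (hf.smul_section hY) hZ, koszul_smul_mid hX hY hf hZ]
        simp only [_root_.add_apply, _root_.smul_apply,
          ContinuousLinearMap.smulRight_apply, inner_add_left, inner_smul_left,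
          inner_leviCivitaAux hX hY hZ]
        simp
        ring }

theorem inner_leviCivita (hX : MDiffAt (T% X) x) (hY : MDiffAt (T% Y) x)
    (hZ : MDiffAt (T% Z) x) :
    inner ℝ (leviCivita I M Y x (X x)) (Z x) = (1 / 2 : ℝ) * koszul X Y Z x :=
  inner_leviCivitaAux hX hY hZ

/-- The Levi-Civita connection is torsion-free. -/
theorem torsion_leviCivita : (leviCivita I M).torsion = 0 := by
  rw [CovariantDerivative.torsion_eq_zero_iff]
  intro X Y x hX hY
  refine ext_inner_right ℝ fun w => ?_
  have hZ : MDiffAt (T% (extend E w : Π y : M, TangentSpace I y)) x := mdifferentiableAt_extend ..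
  have h1 := inner_leviCivita hX hY hZ
  have h2 := inner_leviCivita hY hX hZ
  simp only [extend_apply_self] at h1 h2
  rw [inner_sub_left, h1, h2]
  have e : (fun y => inner ℝ (X y) (Y y)) = fun y => inner ℝ (Y y) (X y) := by
    ext y; exact real_inner_comm _ _
  simp only [koszul, e, extend_apply_self]
  rw [mlieBracket_swap (V := Y) (W := X)]
  simp
  ring

/-- The Levi-Civita connection is compatible with the metric. -/
theorem mvfderiv_inner_leviCivita (hX : MDiffAt (T% X) x) (hY : MDiffAt (T% Y) x)
    (hZ : MDiffAt (T% Z) x) :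
    d% (fun y => inner ℝ (Y y) (Z y)) x (X x) =
      inner ℝ (leviCivita I M Y x (X x)) (Z x) + inner ℝ (Y x) (leviCivita I M Z x (X x)) := by
  have h1 := inner_leviCivita hX hY hZ
  have h2 := inner_leviCivita hX hZ hY
  rw [h1, real_inner_comm (leviCivita I M Z x (X x)) (Y x), h2]
  have c : ∀ (U V : Π x : M, TangentSpace I x),
      (fun y => inner ℝ (U y) (V y)) = fun y => inner ℝ (V y) (U y) := by
    intro U V; ext y; exact real_inner_comm _ _
  simp only [koszul, c Z Y]
  rw [mlieBracket_swap (V := Z) (W := Y)]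
  simp
  ring

end LeviCivita

/-! ### The frame bundle -/

section Frames
open FiberBundle

section
variable (n : ℕ) (M : Type*) [TopologicalSpace M] [ChartedSpace (EuclideanSpace ℝ (Fin n)) M]
  [IsManifold (𝓡 n) ∞ M]

/-- The total space of the smooth vector bundle `Hom(ℝⁿ, TM)` over `M`. -/
abbrev HomBundle : Type _ :=
  TotalSpace ((Fin n → ℝ) →L[ℝ] EuclideanSpace ℝ (Fin n))
    (fun x : M => Bundle.Trivial M (Fin n → ℝ) x →L[ℝ] TangentSpace (𝓡 n) x)

variable {n M} in
/-- The linear map `ℝⁿ → T_x M` underlying a point of `Hom(ℝⁿ, TM)` over `x`. -/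
def homMap (u : HomBundle n M) : (Fin n → ℝ) →L[ℝ] TangentSpace (𝓡 n) u.proj := u.2

/-- The linear maps `u : ℝⁿ → T_x M` for which `(u e₁, …, u eₙ)` is a basis of `T_x M`. -/
def frameSet : Set (HomBundle n M) :=
  {u | LinearIndependent ℝ (fun i : Fin n => homMap u (Pi.single i 1)) ∧
    Submodule.span ℝ (Set.range fun i : Fin n => homMap u (Pi.single i 1)) = ⊤}

variable {n M}

theorem mem_frameSet_iff (u : HomBundle n M) :
    u ∈ frameSet n M ↔ Function.Bijective (homMap u) := by
  have hw : (homMap u : (Fin n → ℝ) →ₗ[ℝ] TangentSpace (𝓡 n) u.proj) =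
      Fintype.linearCombination ℝ (fun i : Fin n => homMap u (Pi.single i 1)) :=
    (Pi.basisFun ℝ (Fin n)).ext fun i => by simp
  have h1 := linearIndependent_iff_injective_fintypeLinearCombination (R := ℝ)
    (v := fun i : Fin n => homMap u (Pi.single i 1))
  have h2 := Fintype.range_linearCombination ℝ (fun i : Fin n => homMap u (Pi.single i 1))
  rw [← hw] at h1 h2
  refine and_congr h1 ?_
  rw [← h2, LinearMap.range_eq_top]
  rfl

theorem homTriv_snd {x₀ : M} {u : HomBundle n M}
    (hu : u.1 ∈ (trivializationAt (EuclideanSpace ℝ (Fin n))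
      (TangentSpace (𝓡 n) : M → Type _) x₀).baseSet) (ξ : Fin n → ℝ) :
    (trivializationAt ((Fin n → ℝ) →L[ℝ] EuclideanSpace ℝ (Fin n))
      (fun x : M => Bundle.Trivial M (Fin n → ℝ) x →L[ℝ] TangentSpace (𝓡 n) x) x₀ u).2 ξ =
    (trivializationAt (EuclideanSpace ℝ (Fin n)) (TangentSpace (𝓡 n) : M → Type _) x₀
      ⟨u.1, homMap u ξ⟩).2 := by
  rw [hom_trivializationAt, Trivialization.continuousLinearMap_apply]
  simp only [ContinuousLinearMap.comp_apply]
  rw [Trivialization.continuousLinearMapAt_apply_of_mem ℝ _ hu]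
  congr 3
  change u.2 (((Bundle.Trivial.trivialization M (Fin n → ℝ)).symmL ℝ u.1) ξ) = u.2 ξ
  rw [Bundle.Trivial.symmL_trivialization]
  rfl

theorem isOpen_frameSet : IsOpen (frameSet n M) := by
  rw [isOpen_iff_mem_nhds]
  intro u₀ hu₀
  set t := trivializationAt ((Fin n → ℝ) →L[ℝ] EuclideanSpace ℝ (Fin n))
      (fun x : M => Bundle.Trivial M (Fin n → ℝ) x →L[ℝ] TangentSpace (𝓡 n) x) u₀.1 with ht
  set e := trivializationAt (EuclideanSpace ℝ (Fin n)) (TangentSpace (𝓡 n) : M → Type _) u₀.1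
    with he
  have hbij : ∀ u : HomBundle n M, u.1 ∈ e.baseSet →
      (u ∈ frameSet n M ↔ Function.Bijective (t u).2) := by
    intro u hu
    have h : ((t u).2 : (Fin n → ℝ) → EuclideanSpace ℝ (Fin n)) =
        e.continuousLinearEquivAt ℝ u.1 hu ∘ homMap u := by
      ext1 ξ
      exact homTriv_snd hu ξ
    rw [h, mem_frameSet_iff]
    exact ((e.continuousLinearEquivAt ℝ u.1 hu).bijective.of_comp_iff' _).symm
  have hmem : u₀.1 ∈ e.baseSet := FiberBundle.mem_baseSet_trivializationAt' _
  have hcont : ContinuousAt (fun u => (t u).2) u₀ :=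
    ((FiberBundle.continuousAt_totalSpace _ (fun w : HomBundle n M => w)).1 continuousAt_id).2
  have hcont1 : ContinuousAt (fun u : HomBundle n M => u.1) u₀ :=
    ((FiberBundle.continuousAt_totalSpace _ (fun w : HomBundle n M => w)).1 continuousAt_id).1
  have hopen : IsOpen {A : (Fin n → ℝ) →L[ℝ] EuclideanSpace ℝ (Fin n) | Function.Bijective A} := by
    convert ContinuousLinearEquiv.isOpen (𝕜 := ℝ) (E := Fin n → ℝ)
      (F := EuclideanSpace ℝ (Fin n)) using 1
    ext A
    constructor
    · intro hA
      exact ⟨(LinearEquiv.ofBijective (A : (Fin n → ℝ) →ₗ[ℝ] EuclideanSpace ℝ (Fin n))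
        hA).toContinuousLinearEquiv, by ext; rfl⟩
    · rintro ⟨L, rfl⟩
      exact L.bijective
  filter_upwards [hcont1 (e.open_baseSet.mem_nhds hmem),
    hcont (hopen.mem_nhds ((hbij u₀ hmem).1 hu₀))] with u h1 h2
  exact (hbij u h1).2 h2

variable (n M) in
/-- The frame bundle `L(M)`, an open submanifold of `Hom(ℝⁿ, TM)`: a point over `x` is a basis
`(u₁, …, uₙ)` of `T_x M`, recorded as the linear isomorphism `u : ℝⁿ → T_x M`, `u eᵢ = uᵢ`.
Its charts are the usual coordinates `(xᵢ, uʲₖ)`, `u_k = ∑ uʲₖ ∂/∂xⱼ`, attached to a chart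
of `M`. -/
def FrameBundle : TopologicalSpace.Opens (HomBundle n M) := ⟨frameSet n M, isOpen_frameSet⟩

/-- The model with corners of the manifold `L(M)`. -/
abbrev frameModel (n : ℕ) :=
  (𝓡 n).prod 𝓘(ℝ, (Fin n → ℝ) →L[ℝ] EuclideanSpace ℝ (Fin n))

end

variable {n : ℕ} {M : Type*} [TopologicalSpace M] [ChartedSpace (EuclideanSpace ℝ (Fin n)) M]
  [IsManifold (𝓡 n) ∞ M]

/-- The projection `π : L(M) → M`. -/
def frameProj (u : FrameBundle n M) : M := u.1.proj

/-- The frame `u` as a linear isomorphism `ℝⁿ → T_{π(u)} M`. -/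
def frameEquiv (u : FrameBundle n M) : (Fin n → ℝ) ≃ₗ[ℝ] TangentSpace (𝓡 n) (frameProj u) :=
  LinearEquiv.ofBijective
    (homMap u.1).toLinearMap ((mem_frameSet_iff u.1).1 u.2)

/-- The map `R_ξ : L(M) → TM`, `u ↦ u ξ`, for `ξ ∈ ℝⁿ`. -/
def rightMul (ξ : Fin n → ℝ) (u : FrameBundle n M) : TangentBundle (𝓡 n) M :=
  ⟨frameProj u, frameEquiv u ξ⟩

/-- The map `R_i : L(M) → TM`, `(u₁, …, uₙ) ↦ u_i`. -/
def frameVector (i : Fin n) : FrameBundle n M → TangentBundle (𝓡 n) M := rightMul (Pi.single i 1)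

/-- The right action of `GL(n)` on `L(M)`: `(u a)_j = ∑ₖ aₖⱼ uₖ`. -/
def frameAct (u : FrameBundle n M) (a : GL (Fin n) ℝ) : FrameBundle n M :=
  ⟨⟨u.1.proj, homMap u.1 ∘L
      LinearMap.toContinuousLinearMap (a : Matrix (Fin n) (Fin n) ℝ).mulVecLin⟩, by
    refine (mem_frameSet_iff _).2 (((mem_frameSet_iff u.1).1 u.2).comp ?_)
    exact ⟨Matrix.mulVec_injective_iff_isUnit.2 a.isUnit,
      Matrix.mulVec_surjective_iff_isUnit.2 a.isUnit⟩⟩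

/-- The matrix exponential, as a map `gl(n) → GL(n)`. -/
def expGL (A : Matrix (Fin n) (Fin n) ℝ) : GL (Fin n) ℝ := (Matrix.isUnit_exp A).unit

/-- The value at `u` of the fundamental vector field `A*` of `A ∈ gl(n)`, i.e. the velocity at
`t = 0` of the curve `t ↦ u exp(tA)`. -/
def fundamentalVector (A : Matrix (Fin n) (Fin n) ℝ) (u : FrameBundle n M) :
    TangentSpace (frameModel n) u :=
  mfderiv 𝓘(ℝ, ℝ) (frameModel n) (fun t : ℝ => frameAct u (expGL (t • A))) 0 (1 : ℝ)

/-- The vertical distribution `ker π_*` of `L(M)`. -/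
def frameVertical (u : FrameBundle n M) : Submodule ℝ (TangentSpace (frameModel n) u) :=
  LinearMap.ker (mfderiv (frameModel n) (𝓡 n) frameProj u).toLinearMap

/-- The subspace spanned by the fundamental vectors `A*` of the matrices `A` all of whose columns
except possibly the `i`-th one vanish. -/
def frameVerticalColumn (i : Fin n) (u : FrameBundle n M) :
    Submodule ℝ (TangentSpace (frameModel n) u) :=
  Submodule.span ℝ {ξ | ∃ A : Matrix (Fin n) (Fin n) ℝ,
    (∀ k j, j ≠ i → A k j = 0) ∧ ξ = fundamentalVector A u}

/-- The vertical distribution `ker (π_TM)_*` of `TM`. -/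
def tangentVertical (ζ : TangentBundle (𝓡 n) M) :
    Submodule ℝ (TangentSpace (𝓡 n).tangent ζ) :=
  LinearMap.ker (mfderiv (𝓡 n).tangent (𝓡 n)
    (TotalSpace.proj : TangentBundle (𝓡 n) M → M) ζ).toLinearMap

/-! ### Derivatives of the basic maps -/

theorem hasMFDerivAt_frameProj (u : FrameBundle n M) :
    HasMFDerivAt (frameModel n) (𝓡 n) frameProj u
      (ContinuousLinearMap.fst ℝ (EuclideanSpace ℝ (Fin n))
        ((Fin n → ℝ) →L[ℝ] EuclideanSpace ℝ (Fin n))) :=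
  (hasMFDerivAt_coords (I := 𝓡 n) u.1).1.comp u (hasMFDerivAt_opens_val u)

theorem hasMFDerivAt_frameTriv (u : FrameBundle n M) :
    HasMFDerivAt (frameModel n) 𝓘(ℝ, (Fin n → ℝ) →L[ℝ] EuclideanSpace ℝ (Fin n))
      (fun w : FrameBundle n M => (trivializationAt ((Fin n → ℝ) →L[ℝ] EuclideanSpace ℝ (Fin n))
        (fun x : M => Bundle.Trivial M (Fin n → ℝ) x →L[ℝ] TangentSpace (𝓡 n) x)
        (frameProj u) w.1).2) u
      (ContinuousLinearMap.snd ℝ (EuclideanSpace ℝ (Fin n))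
        ((Fin n → ℝ) →L[ℝ] EuclideanSpace ℝ (Fin n))) :=
  (hasMFDerivAt_coords (I := 𝓡 n) u.1).2.comp u (hasMFDerivAt_opens_val u)

theorem hasMFDerivAt_rightMul (ξ : Fin n → ℝ) (u : FrameBundle n M) :
    HasMFDerivAt (frameModel n) (𝓡 n).tangent (rightMul ξ) u
      ((ContinuousLinearMap.fst ℝ (EuclideanSpace ℝ (Fin n))
        ((Fin n → ℝ) →L[ℝ] EuclideanSpace ℝ (Fin n))).prod
        ((ContinuousLinearMap.apply ℝ (EuclideanSpace ℝ (Fin n)) ξ) ∘L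
          (ContinuousLinearMap.snd ℝ (EuclideanSpace ℝ (Fin n))
        ((Fin n → ℝ) →L[ℝ] EuclideanSpace ℝ (Fin n))))) := by
  refine hasMFDerivAt_totalSpace (hasMFDerivAt_frameProj u) ?_
  have h := (ContinuousLinearMap.apply ℝ (EuclideanSpace ℝ (Fin n)) ξ).hasMFDerivAt.comp u
    (hasMFDerivAt_frameTriv u)
  refine h.congr_of_eventuallyEq ?_
  have hb := (hasMFDerivAt_frameProj u).1.eventually
    ((trivializationAt (EuclideanSpace ℝ (Fin n)) (TangentSpace (𝓡 n) : M → Type _)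
      (frameProj u)).open_baseSet.mem_nhds (FiberBundle.mem_baseSet_trivializationAt' _))
  filter_upwards [hb] with w hw using (homTriv_snd hw ξ).symm

theorem mfderiv_tangentProj (ζ : TangentBundle (𝓡 n) M) :
    mfderiv (𝓡 n).tangent (𝓡 n) (TotalSpace.proj : TangentBundle (𝓡 n) M → M) ζ =
      ContinuousLinearMap.fst ℝ (EuclideanSpace ℝ (Fin n)) (EuclideanSpace ℝ (Fin n)) :=
  (hasMFDerivAt_coords (I := 𝓡 n) ζ).1.mfderiv

theorem mfderiv_frameProj (u : FrameBundle n M) :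
    mfderiv (frameModel n) (𝓡 n) frameProj u =
      ContinuousLinearMap.fst ℝ (EuclideanSpace ℝ (Fin n))
        ((Fin n → ℝ) →L[ℝ] EuclideanSpace ℝ (Fin n)) :=
  (hasMFDerivAt_frameProj u).mfderiv

theorem triv_self (x : M) (v : TangentSpace (𝓡 n) x) :
    (trivializationAt (EuclideanSpace ℝ (Fin n)) (TangentSpace (𝓡 n) : M → Type _) x ⟨x, v⟩).2 =
      v := by
  rw [TangentBundle.trivializationAt_apply]
  exact tangentCoordChange_self (I := 𝓡 n) (mem_extChartAt_source x)

/-- The coefficients of a vector field in the preferred chart at `x`. -/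
def fieldCoords (x : M) (σ : Π y : M, TangentSpace (𝓡 n) y) (y : M) : EuclideanSpace ℝ (Fin n) :=
  (trivializationAt (EuclideanSpace ℝ (Fin n)) (TangentSpace (𝓡 n) : M → Type _)
    x).continuousLinearMapAt ℝ y (σ y)

theorem fieldCoords_eventuallyEq (x : M) (σ : Π y : M, TangentSpace (𝓡 n) y) :
    fieldCoords x σ =ᶠ[𝓝 x] fun y => (trivializationAt (EuclideanSpace ℝ (Fin n))
      (TangentSpace (𝓡 n) : M → Type _) x ⟨y, σ y⟩).2 := by
  filter_upwards [(trivializationAt (EuclideanSpace ℝ (Fin n)) (TangentSpace (𝓡 n) : M → Type _)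
    x).open_baseSet.mem_nhds (FiberBundle.mem_baseSet_trivializationAt' _)] with y hy
  exact Trivialization.continuousLinearMapAt_apply_of_mem ℝ _ hy _

theorem hasMFDerivAt_section {σ : Π x : M, TangentSpace (𝓡 n) x} {x : M}
    (hσ : MDifferentiableAt (𝓡 n) (𝓡 n).tangent (fun y => (⟨y, σ y⟩ : TangentBundle (𝓡 n) M)) x) :
    MDifferentiableAt (𝓡 n) 𝓘(ℝ, EuclideanSpace ℝ (Fin n)) (fieldCoords x σ) x ∧
    HasMFDerivAt (𝓡 n) (𝓡 n).tangent (fun y => (⟨y, σ y⟩ : TangentBundle (𝓡 n) M)) x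
      ((ContinuousLinearMap.id ℝ (EuclideanSpace ℝ (Fin n))).prod
        (mvfderiv (𝓡 n) (fieldCoords x σ) x)) := by
  have h := ((mdifferentiableAt_totalSpace _ _).1 hσ).2
  have h' : MDifferentiableAt (𝓡 n) 𝓘(ℝ, EuclideanSpace ℝ (Fin n)) (fieldCoords x σ) x :=
    h.congr_of_eventuallyEq (fieldCoords_eventuallyEq x σ)
  refine ⟨h', hasMFDerivAt_totalSpace (hasMFDerivAt_id x) ?_⟩
  exact h'.hasMFDerivAt.congr_of_eventuallyEq (fieldCoords_eventuallyEq x σ).symm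

theorem hasMFDerivAt_act (u : FrameBundle n M) (A : Matrix (Fin n) (Fin n) ℝ) :
    HasMFDerivAt 𝓘(ℝ, ℝ) (frameModel n) (fun t : ℝ => frameAct u (expGL (t • A))) 0
      ((0 : ℝ →L[ℝ] EuclideanSpace ℝ (Fin n)).prod
       ((ContinuousLinearMap.toSpanSingleton ℝ ((homMap u.1 ∘L
      LinearMap.toContinuousLinearMap A.mulVecLin : (Fin n → ℝ) →L[ℝ] EuclideanSpace ℝ (Fin n)))))) := by
  refine hasMFDerivAt_opens_iff.1 (hasMFDerivAt_totalSpace (hasMFDerivAt_const _ _) ?_)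
  let Φ : Matrix (Fin n) (Fin n) ℝ →ₗ[ℝ] ((Fin n → ℝ) →L[ℝ] EuclideanSpace ℝ (Fin n)) :=
   { toFun := fun B => homMap u.1 ∘L LinearMap.toContinuousLinearMap B.mulVecLin
     map_add' := fun B C => by
      ext1 ξ
      exact (congrArg (homMap u.1) (Matrix.add_mulVec B C ξ)).trans ((homMap u.1).map_add _ _)
     map_smul' := fun c B => by
      ext1 ξ
      exact (congrArg (homMap u.1) (Matrix.smul_mulVec c B ξ)).trans ((homMap u.1).map_smul _ _) }
  have hd : HasDerivAt (fun t : ℝ => Φ (NormedSpace.exp (t • A))) (Φ A) 0 := by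
    open scoped Matrix.Norms.Operator in
    have h := hasDerivAt_exp_smul_const (𝕂 := ℝ) A 0
    rw [zero_smul, NormedSpace.exp_zero, one_mul] at h
    exact (LinearMap.toContinuousLinearMap Φ).hasFDerivAt.comp_hasDerivAt (0 : ℝ) h
  have hd' := hd.hasFDerivAt.hasMFDerivAt
  refine hd'.congr_of_eventuallyEq (Filter.Eventually.of_forall fun t => ?_)
  ext1 ξ
  refine (homTriv_snd (FiberBundle.mem_baseSet_trivializationAt' _) ξ).trans ?_
  exact triv_self _ _

theorem mfderiv_rightMul_parts (ξ : Fin n → ℝ) (u : FrameBundle n M)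
    (w : TangentSpace (frameModel n) u) :
    mfderiv (frameModel n) (𝓡 n).tangent (rightMul ξ) u w =
      ((w : EuclideanSpace ℝ (Fin n) × ((Fin n → ℝ) →L[ℝ] EuclideanSpace ℝ (Fin n))).1,
        (w : EuclideanSpace ℝ (Fin n) × ((Fin n → ℝ) →L[ℝ] EuclideanSpace ℝ (Fin n))).2 ξ) := by
  rw [(hasMFDerivAt_rightMul ξ u).mfderiv]; rfl

/-! ### The connection on `TM` and on `L(M)` -/

section Connection
variable (cov : CovariantDerivative (𝓡 n) (EuclideanSpace ℝ (Fin n))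
  (TangentSpace (𝓡 n) : M → Type _))

/-- The fibre part of a tangent vector of `TM` at `ζ`, read in the coordinates of `TM` induced by
the preferred chart of `M` at `x = π(ζ)`; that chart identifies the model fibre with `T_x M`. -/
def tangentFiberPart (ζ : TangentBundle (𝓡 n) M) :
    TangentSpace (𝓡 n).tangent ζ →L[ℝ] TangentSpace (𝓡 n) ζ.proj :=
  ContinuousLinearMap.snd ℝ (EuclideanSpace ℝ (Fin n)) (EuclideanSpace ℝ (Fin n))

/-- The `j`-th column of the fibre part of a tangent vector of `L(M)` at `u`, read in the
coordinates `(xᵢ, uʲₖ)` of `L(M)` induced by the preferred chart of `M` at `x = π(u)`; that chart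
identifies the model fibre with `T_x M`. -/
def frameFiberPart (u : FrameBundle n M) (j : Fin n) :
    TangentSpace (frameModel n) u →L[ℝ] TangentSpace (𝓡 n) (frameProj u) :=
  (ContinuousLinearMap.apply ℝ (EuclideanSpace ℝ (Fin n)) (Pi.single j 1)) ∘L
    ContinuousLinearMap.snd ℝ (EuclideanSpace ℝ (Fin n))
      ((Fin n → ℝ) →L[ℝ] EuclideanSpace ℝ (Fin n))

theorem frame_ext {u : FrameBundle n M} {ξ η : TangentSpace (frameModel n) u}
    (h₁ : mfderiv (frameModel n) (𝓡 n) frameProj u ξ = mfderiv (frameModel n) (𝓡 n) frameProj u η)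
    (h₂ : ∀ j, frameFiberPart u j ξ = frameFiberPart u j η) : ξ = η := by
  rw [mfderiv_frameProj] at h₁
  refine Prod.ext h₁ (ContinuousLinearMap.coe_injective ((Pi.basisFun ℝ (Fin n)).ext fun j => ?_))
  simpa using! h₂ j

theorem exists_frame_vector (u : FrameBundle n M) (v : TangentSpace (𝓡 n) (frameProj u))
    (b : Fin n → TangentSpace (𝓡 n) (frameProj u)) :
    ∃ ξ : TangentSpace (frameModel n) u, mfderiv (frameModel n) (𝓡 n) frameProj u ξ = v ∧
      ∀ j, frameFiberPart u j ξ = b j := by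
  refine ⟨(v, LinearMap.toContinuousLinearMap ((Pi.basisFun ℝ (Fin n)).constr ℝ b)), ?_, ?_⟩
  · rw [mfderiv_frameProj]; rfl
  · intro j
    have := (Pi.basisFun ℝ (Fin n)).constr_basis ℝ b j
    rw [Pi.basisFun_apply] at this
    exact this

theorem fundamentalVector_parts (u : FrameBundle n M) (A : Matrix (Fin n) (Fin n) ℝ) :
    mfderiv (frameModel n) (𝓡 n) frameProj u (fundamentalVector A u) = 0 ∧
    ∀ j, frameFiberPart u j (fundamentalVector A u) = frameEquiv u fun k => A k j := by
  have h : fundamentalVector A u = ((0 : EuclideanSpace ℝ (Fin n)), (homMap u.1 ∘L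
      LinearMap.toContinuousLinearMap A.mulVecLin :
        (Fin n → ℝ) →L[ℝ] EuclideanSpace ℝ (Fin n))) := by
    rw [fundamentalVector, (hasMFDerivAt_act u A).mfderiv]
    exact Prod.ext rfl (one_smul ℝ _)
  constructor
  · rw [mfderiv_frameProj, h]; rfl
  · intro j
    rw [h]
    exact congrArg (homMap u.1) (Matrix.mulVec_single_one A j)

/-- The connection map `K : T_ζ TM → T_x M` of `∇`, `x = π(ζ)`. In the coordinates `(a, b)` of
`T_ζ TM` induced by the preferred chart of `M` at `x` it is `K(a, b) = b + ∇_a Z`, where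
`Z = extend _ ζ.2` is the local vector field with `Z x = ζ` and constant coefficients in that
chart. It is the linear map with `K (σ_* v) = ∇_v σ` for all local vector fields `σ`, see
`connectionMap_mfderiv_section`. -/
def connectionMap (ζ : TangentBundle (𝓡 n) M) :
    TangentSpace (𝓡 n).tangent ζ →L[ℝ] TangentSpace (𝓡 n) ζ.proj :=
  tangentFiberPart ζ + (cov (extend (EuclideanSpace ℝ (Fin n)) ζ.2) ζ.proj) ∘L
    mfderiv (𝓡 n).tangent (𝓡 n) (TotalSpace.proj : TangentBundle (𝓡 n) M → M) ζ

/-- The connection map satisfies `K (σ_* v) = ∇_v σ` for local vector fields `σ`. -/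
theorem connectionMap_mfderiv_section {σ : Π x : M, TangentSpace (𝓡 n) x} {x : M}
    (hσ : MDifferentiableAt (𝓡 n) (𝓡 n).tangent (fun y => (⟨y, σ y⟩ : TangentBundle (𝓡 n) M)) x)
    (v : TangentSpace (𝓡 n) x) :
    connectionMap cov ⟨x, σ x⟩
      (mfderiv (𝓡 n) (𝓡 n).tangent (fun y => (⟨y, σ y⟩ : TangentBundle (𝓡 n) M)) x v) =
      cov σ x v := by
  let c : (Π x : M, TangentSpace (𝓡 n) x) → EuclideanSpace ℝ (Fin n) := fun τ => cov τ x v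
  let Φ : (Π x : M, TangentSpace (𝓡 n) x) → EuclideanSpace ℝ (Fin n) := fun τ =>
    c τ - mvfderiv (𝓡 n) (fieldCoords x τ) x v
  have hΦ : TensorialAt (𝓡 n) (EuclideanSpace ℝ (Fin n)) Φ x := by
    constructor
    · intro f τ hf hτ
      have e : fieldCoords x (f • τ) = f • fieldCoords x τ := by
        ext1 y
        exact (Trivialization.continuousLinearMapAt ℝ _ y).map_smul (f y) (τ y)
      simp only [Φ, c, e]
      rw [cov.isCovariantDerivativeOnUniv.leibniz hτ hf,
        mvfderiv_smul hf (hasMFDerivAt_section hτ).1]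
      have e2 : fieldCoords x τ x = τ x :=
        (fieldCoords_eventuallyEq x τ).self_of_nhds.trans (triv_self x (τ x))
      rw [e2]
      let p : EuclideanSpace ℝ (Fin n) := τ x
      change f x • c τ + (mvfderiv (𝓡 n) f x v) • p -
        (f x • mvfderiv (𝓡 n) (fieldCoords x τ) x v + (mvfderiv (𝓡 n) f x v) • p) =
        f x • (c τ - mvfderiv (𝓡 n) (fieldCoords x τ) x v)
      module
    · intro τ τ' hτ hτ'
      have e : fieldCoords x (τ + τ') = fieldCoords x τ + fieldCoords x τ' := by
        ext1 y
        exact (Trivialization.continuousLinearMapAt ℝ _ y).map_add (τ y) (τ' y)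
      simp only [Φ, c, e]
      rw [cov.isCovariantDerivativeOnUniv.add hτ hτ',
        mvfderiv_add (hasMFDerivAt_section hτ).1 (hasMFDerivAt_section hτ').1]
      change c τ + c τ' - (mvfderiv (𝓡 n) (fieldCoords x τ) x v +
        mvfderiv (𝓡 n) (fieldCoords x τ') x v) = (c τ - mvfderiv (𝓡 n) (fieldCoords x τ) x v)
        + (c τ' - mvfderiv (𝓡 n) (fieldCoords x τ') x v)
      module
  have h0 : mvfderiv (𝓡 n) (fieldCoords x (extend (EuclideanSpace ℝ (Fin n)) (σ x))) x v = 0 := by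
    have hc : fieldCoords x (extend (EuclideanSpace ℝ (Fin n)) (σ x)) =ᶠ[𝓝 x]
        fun _ => (trivializationAt (EuclideanSpace ℝ (Fin n))
          (TangentSpace (𝓡 n) : M → Type _) x ⟨x, σ x⟩).2 := by
      filter_upwards [(trivializationAt (EuclideanSpace ℝ (Fin n))
        (TangentSpace (𝓡 n) : M → Type _) x).open_baseSet.mem_nhds
        (FiberBundle.mem_baseSet_trivializationAt' _)] with y hy
      rw [fieldCoords, Trivialization.continuousLinearMapAt_apply_of_mem ℝ _ hy]
      have h := Trivialization.apply_mk_symm _ hy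
        (trivializationAt (EuclideanSpace ℝ (Fin n)) (TangentSpace (𝓡 n) : M → Type _) x
          ⟨x, σ x⟩).2
      have h' := congrArg Prod.snd h
      exact h'
    have hm : mfderiv (𝓡 n) 𝓘(ℝ, EuclideanSpace ℝ (Fin n))
        (fieldCoords x (extend (EuclideanSpace ℝ (Fin n)) (σ x))) x = 0 :=
      ((hasMFDerivAt_const _ x).congr_of_eventuallyEq hc).mfderiv
    simp [mvfderiv, hm]
  have h1 := hΦ.pointwise hσ
    (mdifferentiableAt_extend (𝓡 n) (EuclideanSpace ℝ (Fin n)) (σ x)) (by simp)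
  change c σ - mvfderiv (𝓡 n) (fieldCoords x σ) x v =
    c (extend (EuclideanSpace ℝ (Fin n)) (σ x)) -
      mvfderiv (𝓡 n) (fieldCoords x (extend (EuclideanSpace ℝ (Fin n)) (σ x))) x v at h1
  rw [h0, sub_zero] at h1
  rw [(hasMFDerivAt_section hσ).2.mfderiv]
  unfold connectionMap
  rw [mfderiv_tangentProj]
  exact (eq_add_of_sub_eq' h1).symm

/-- The covariant differential of the `j`-th frame vector, a linear map `T_u L(M) → T_x M`,
`x = π(u)`. In the coordinates `(a, b)` of `T_u L(M)` induced by the preferred chart of `M` at `x`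
it is `(a, b) ↦ b_j + ∇_a Z_j`, where `Z_j = extend _ u_j` is the local vector field with
`Z_j x = u_j` and constant coefficients in that chart. -/
def frameCovariantDifferential (u : FrameBundle n M) (j : Fin n) :
    TangentSpace (frameModel n) u →L[ℝ] TangentSpace (𝓡 n) (frameProj u) :=
  frameFiberPart u j + (cov (extend (EuclideanSpace ℝ (Fin n)) (frameVector j u).2) (frameProj u)) ∘L
    mfderiv (frameModel n) (𝓡 n) frameProj u

/-- The connection form `ω` of `L(M)` corresponding to `∇`, with values in `gl(n)`: the `j`-th
column of `ω(ξ)` consists of the components, in the frame `u`, of the covariant differential of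
the `j`-th frame vector in the direction `ξ`, i.e. locally `ω = u⁻¹ (du + Γ(dx) u)`. It is the linear
map with `ω(A*) = A` and with `∇_v s_j = ∑ₖ ω(s_* v)ₖⱼ s_k` for all local sections
`s = (s₁, …, sₙ)` of `L(M)`, see `connectionForm_fundamentalVector` and
`connectionForm_mfderiv_section`. -/
def connectionForm (u : FrameBundle n M) :
    TangentSpace (frameModel n) u →ₗ[ℝ] Matrix (Fin n) (Fin n) ℝ where
  toFun ξ := Matrix.of fun k j => (frameEquiv u).symm (frameCovariantDifferential cov u j ξ) k
  map_add' ξ η := by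
    ext k j
    simp only [(frameCovariantDifferential cov u j).map_add, (frameEquiv u).symm.map_add,
      Matrix.of_apply, Matrix.add_apply, Pi.add_apply]
  map_smul' c ξ := by
    ext k j
    simp only [(frameCovariantDifferential cov u j).map_smul, (frameEquiv u).symm.map_smul,
      Matrix.of_apply, Matrix.smul_apply, Pi.smul_apply, RingHom.id_apply]

/-- The connection form reproduces the generators of fundamental vector fields: `ω(A*) = A`. -/
theorem connectionForm_fundamentalVector (u : FrameBundle n M) (A : Matrix (Fin n) (Fin n) ℝ) :
    connectionForm cov u (fundamentalVector A u) = A := by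
  ext k j
  change (frameEquiv u).symm (frameFiberPart u j (fundamentalVector A u) +
    cov (extend (EuclideanSpace ℝ (Fin n)) (frameVector j u).2) (frameProj u)
    (mfderiv (frameModel n) (𝓡 n) frameProj u (fundamentalVector A u))) k = A k j
  rw [(fundamentalVector_parts u A).1, (fundamentalVector_parts u A).2 j,
    ContinuousLinearMap.map_zero, add_zero, LinearEquiv.symm_apply_apply]

theorem connectionMap_mfderiv_frameVector (u : FrameBundle n M) (j : Fin n)
    (w : TangentSpace (frameModel n) u) :
    connectionMap cov (frameVector j u) (mfderiv (frameModel n) (𝓡 n).tangent (frameVector j) u w) =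
      frameCovariantDifferential cov u j w := by
  unfold connectionMap frameCovariantDifferential
  rw [mfderiv_tangentProj, mfderiv_frameProj]
  have h := mfderiv_rightMul_parts (Pi.single j 1) u w
  rw [frameVector, h]
  rfl

theorem connectionForm_sum (u : FrameBundle n M) (j : Fin n) (w : TangentSpace (frameModel n) u) :
    ∑ k, connectionForm cov u w k j • (frameVector k u).2 = frameCovariantDifferential cov u j w := by
  have h := (frameEquiv u).apply_symm_apply (frameCovariantDifferential cov u j w)
  conv_rhs => rw [← h]
  rw [← Finset.univ_sum_single ((frameEquiv u).symm (frameCovariantDifferential cov u j w)), map_sum]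
  refine Finset.sum_congr rfl fun k _ => ?_
  have : (Pi.single k ((frameEquiv u).symm (frameCovariantDifferential cov u j w) k) : Fin n → ℝ) =
    ((frameEquiv u).symm (frameCovariantDifferential cov u j w) k) • Pi.single k 1 := by
    rw [← Pi.single_smul, smul_eq_mul, mul_one]
  rw [this, map_smul]
  rfl

theorem connectionMap_eq_sum {x : M} {u : FrameBundle n M} {τ : Fin n → TangentSpace (𝓡 n) x}
    (h : ∀ j, frameVector j u = ⟨x, τ j⟩) (j : Fin n) (w : TangentSpace (frameModel n) u) :
    connectionMap cov ⟨x, τ j⟩ (mfderiv (frameModel n) (𝓡 n).tangent (frameVector j) u w) =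
      ∑ k, connectionForm cov u w k j • τ k := by
  have hx : frameProj u = x := congrArg TotalSpace.proj (h j)
  subst hx
  have hτ : τ = fun j => (frameVector j u).2 := by
    funext j
    have := h j
    rw [TotalSpace.ext_iff] at this
    exact (eq_of_heq this.2).symm
  subst hτ
  exact (connectionMap_mfderiv_frameVector cov u j w).trans (connectionForm_sum cov u j w).symm

/-- For a local section `s = (σ₁, …, σₙ)` of `L(M)` the connection form satisfies
`∇_v σⱼ = ∑ₖ ω(s_* v)ₖⱼ σₖ`. -/
theorem connectionForm_mfderiv_section {x : M} (s : M → FrameBundle n M)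
    (σ : Fin n → Π y : M, TangentSpace (𝓡 n) y)
    (hσ : ∀ᶠ y in 𝓝 x, ∀ j, frameVector j (s y) = ⟨y, σ j y⟩)
    (hs : MDifferentiableAt (𝓡 n) (frameModel n) s x) (v : TangentSpace (𝓡 n) x) (j : Fin n) :
    cov (σ j) x v =
      ∑ k, connectionForm cov (s x) (mfderiv (𝓡 n) (frameModel n) s x v) k j • σ k x := by
  have hx : ∀ j, frameVector j (s x) = ⟨x, σ j x⟩ := hσ.self_of_nhds
  have hd := (hasMFDerivAt_rightMul (Pi.single j 1) (s x)).comp x hs.hasMFDerivAt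
  have hd' := hd.congr_of_eventuallyEq (f₁ := fun y => (⟨y, σ j y⟩ : TangentBundle (𝓡 n) M))
    (hσ.mono fun y hy => (hy j).symm)
  have h1 := connectionMap_mfderiv_section cov hd'.mdifferentiableAt v
  rw [hd'.mfderiv] at h1
  rw [← h1, ← connectionMap_eq_sum cov hx]
  rw [frameVector, (hasMFDerivAt_rightMul (Pi.single j 1) (s x)).mfderiv]
  rfl

/-- The horizontal distribution `ker K` of `TM`. -/
def tangentHorizontal (ζ : TangentBundle (𝓡 n) M) :
    Submodule ℝ (TangentSpace (𝓡 n).tangent ζ) :=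
  LinearMap.ker (connectionMap cov ζ).toLinearMap

/-- The horizontal distribution `ker ω` of `L(M)`. -/
def frameHorizontal (u : FrameBundle n M) : Submodule ℝ (TangentSpace (frameModel n) u) :=
  LinearMap.ker (connectionForm cov u)

theorem mem_frameHorizontal_iff {u : FrameBundle n M} {ξ : TangentSpace (frameModel n) u} :
    ξ ∈ frameHorizontal cov u ↔ ∀ j, frameCovariantDifferential cov u j ξ = 0 := by
  constructor
  · intro h j
    rw [← (frameEquiv u).symm.map_eq_zero_iff]
    ext k
    exact congrFun (congrFun h k) j
  · intro h
    ext k j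
    change (frameEquiv u).symm (frameCovariantDifferential cov u j ξ) k = 0
    rw [h j, map_zero]; rfl

theorem existsUnique_tangentHorizontal (ζ : TangentBundle (𝓡 n) M)
    (v : TangentSpace (𝓡 n) ζ.proj) :
    ∃! ξ : TangentSpace (𝓡 n).tangent ζ, ξ ∈ tangentHorizontal cov ζ ∧
      mfderiv (𝓡 n).tangent (𝓡 n) (TotalSpace.proj : TangentBundle (𝓡 n) M → M) ζ ξ = v := by
  have hmem : ∀ ξ : TangentSpace (𝓡 n).tangent ζ, ξ ∈ tangentHorizontal cov ζ ↔
      tangentFiberPart ζ ξ = - cov (extend (EuclideanSpace ℝ (Fin n)) ζ.2) ζ.proj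
       (mfderiv (𝓡 n).tangent (𝓡 n) (TotalSpace.proj : TangentBundle (𝓡 n) M → M) ζ ξ) :=
    fun ξ => eq_neg_iff_add_eq_zero.symm
  refine ⟨(v, - cov (extend (EuclideanSpace ℝ (Fin n)) ζ.2) ζ.proj v), ?_, ?_⟩
  · have h : mfderiv (𝓡 n).tangent (𝓡 n) (TotalSpace.proj : TangentBundle (𝓡 n) M → M) ζ
      (v, - cov (extend (EuclideanSpace ℝ (Fin n)) ζ.2) ζ.proj v) = v := by
      rw [mfderiv_tangentProj]; rfl
    refine ⟨(hmem _).2 ?_, h⟩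
    rw [h]; rfl
  · rintro ξ ⟨h1, h2⟩
    rw [hmem, h2] at h1
    rw [mfderiv_tangentProj] at h2
    exact Prod.ext h2 h1

theorem existsUnique_frameHorizontal (u : FrameBundle n M) (v : TangentSpace (𝓡 n) (frameProj u)) :
    ∃! ξ : TangentSpace (frameModel n) u, ξ ∈ frameHorizontal cov u ∧
      mfderiv (frameModel n) (𝓡 n) frameProj u ξ = v := by
  have hmem : ∀ ξ : TangentSpace (frameModel n) u, ξ ∈ frameHorizontal cov u ↔
      ∀ j, frameFiberPart u j ξ =
        - cov (extend (EuclideanSpace ℝ (Fin n)) (frameVector j u).2) (frameProj u)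
          (mfderiv (frameModel n) (𝓡 n) frameProj u ξ) :=
    fun ξ => (mem_frameHorizontal_iff cov).trans (forall_congr' fun j => eq_neg_iff_add_eq_zero.symm)
  obtain ⟨ξ, h1, h2⟩ := exists_frame_vector u v fun j =>
    - cov (extend (EuclideanSpace ℝ (Fin n)) (frameVector j u).2) (frameProj u) v
  refine ⟨ξ, ⟨(hmem ξ).2 fun j => by rw [h1]; exact h2 j, h1⟩, ?_⟩
  rintro η ⟨h3, h4⟩
  refine frame_ext (h4.trans h1.symm) fun j => ?_
  rw [(hmem η).1 h3 j, h4]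
  exact (h2 j).symm

/-- The horizontal lift `X^{h,TM}` of a vector field `X`: its value at `ζ` is the unique horizontal
vector that projects to `X` under `(π_TM)_*`. -/
def tangentHorizontalLift (X : Π x : M, TangentSpace (𝓡 n) x) (ζ : TangentBundle (𝓡 n) M) :
    TangentSpace (𝓡 n).tangent ζ :=
  (existsUnique_tangentHorizontal cov ζ (X ζ.proj)).choose

/-- The horizontal lift `X^h` of a vector field `X`: its value at `u` is the unique horizontal
vector that projects to `X` under `π_*`. -/
def frameHorizontalLift (X : Π x : M, TangentSpace (𝓡 n) x) (u : FrameBundle n M) :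
    TangentSpace (frameModel n) u :=
  (existsUnique_frameHorizontal cov u (X (frameProj u))).choose

end Connection

end Frames

end FrameBundleGeometry

end

open FrameBundleGeometry

/-!
Fix a frame `u` over `x` and a tangent vector `w` of `L(M)` at `u`. The proof rests on the identity
`K ((R_ξ)_* w) = u (ω(w) ξ)` (`connectionMap_mfderiv_rightMul`): in the coordinates of a chart both
sides are `b ξ + ∇_a (u ξ)`, where `w = (a, b)` and the vector `u ξ` is extended to a field with
constant coefficients, so that the expression is linear in `ξ`. Together with
`π_TM ∘ R_ξ = π` it shows that `(R_ξ)_*` maps `ker ω` to `ker K` compatibly with the projections to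
`T_x M`. Both horizontal spaces are mapped isomorphically onto `T_x M`, which gives the statement
on horizontal lifts and the one on horizontal distributions.

For the vertical part, a vertical vector is determined by its columns, the fibre parts of
`(R_j)_* w`, and these columns are arbitrary: the fundamental vector `A*` has the columns `u (A e_j)`
(`fundamentalVector_parts`). Hence `V^i` consists of the vertical vectors whose columns other than
the `i`-th one vanish (`mem_frameVerticalColumn_iff`), and the claims on `V^i` reduce to the
decomposition of a matrix into its columns.
-/

noncomputable section

namespace FrameBundleGeometry

open FiberBundle

/-! ### Constant extensions of vectors -/

section Extend
variable {B F : Type*} [TopologicalSpace B] [NormedAddCommGroup F] [NormedSpace ℝ F]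
  {V : B → Type*} [∀ x, AddCommGroup (V x)] [∀ x, Module ℝ (V x)]
  [TopologicalSpace (TotalSpace F V)] [∀ x, TopologicalSpace (V x)] [FiberBundle F V]
  [VectorBundle ℝ F V]

/-- Constant extensions agree near the base point with the image of a fixed vector under the
linear inverse of the trivialization. Outside the base set of the trivialization `extend` takes
unspecified values, so there the two sides may differ. -/
theorem extend_eventuallyEq_symmₗ {x : B} (v : V x) :
    ∀ᶠ y in 𝓝 x, extend F v y =
      (trivializationAt F V x).symmₗ ℝ y ((trivializationAt F V x).linearMapAt ℝ x v) := by
  have hx : x ∈ (trivializationAt F V x).baseSet := mem_baseSet_trivializationAt' x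
  filter_upwards [(trivializationAt F V x).open_baseSet.mem_nhds hx] with y hy
  rw [Trivialization.coe_linearMapAt_of_mem _ hx, Trivialization.symmₗ_apply _ hy]
  rfl

theorem extend_add_eventuallyEq {x : B} (v w : V x) :
    ∀ᶠ y in 𝓝 x, extend F (v + w) y = (extend F v + extend F w : Π y, V y) y := by
  filter_upwards [extend_eventuallyEq_symmₗ (F := F) v, extend_eventuallyEq_symmₗ (F := F) w,
    extend_eventuallyEq_symmₗ (F := F) (v + w)] with y h1 h2 h3
  rw [Pi.add_apply, h1, h2, h3, map_add, map_add]

theorem extend_smul_eventuallyEq {x : B} (c : ℝ) (v : V x) :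
    ∀ᶠ y in 𝓝 x, extend F (c • v) y = (c • extend F v : Π y, V y) y := by
  filter_upwards [extend_eventuallyEq_symmₗ (F := F) v,
    extend_eventuallyEq_symmₗ (F := F) (c • v)] with y h1 h2
  rw [Pi.smul_apply, h1, h2, map_smul, map_smul]

end Extend

variable {n : ℕ} {M : Type*} [TopologicalSpace M] [ChartedSpace (EuclideanSpace ℝ (Fin n)) M]
  [IsManifold (𝓡 n) ∞ M]

/-! ### Horizontal distributions -/

section Connection
variable (cov : CovariantDerivative (𝓡 n) (EuclideanSpace ℝ (Fin n))
  (TangentSpace (𝓡 n) : M → Type _))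

/-- The Christoffel term `v ↦ ∇_a Z` of a connection at `x`, where `Z` is the constant extension
of `v`, as a linear map. -/
def christoffelMap {x : M} (a : TangentSpace (𝓡 n) x) :
    TangentSpace (𝓡 n) x →ₗ[ℝ] TangentSpace (𝓡 n) x where
  toFun v := cov (extend (EuclideanSpace ℝ (Fin n)) v) x a
  map_add' v w := by
    rw [cov.isCovariantDerivativeOnUniv.congr_of_eventuallyEq (mdifferentiableAt_extend ..)
      (mdifferentiableAt_add_section (mdifferentiableAt_extend ..) (mdifferentiableAt_extend ..))
      Filter.univ_mem (extend_add_eventuallyEq v w),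
      cov.isCovariantDerivativeOnUniv.add (mdifferentiableAt_extend ..)
      (mdifferentiableAt_extend ..)]
    rfl
  map_smul' c v := by
    rw [cov.isCovariantDerivativeOnUniv.congr_of_eventuallyEq (mdifferentiableAt_extend ..)
      (MDifferentiableAt.smul_const_section (mdifferentiableAt_extend ..))
      Filter.univ_mem (extend_smul_eventuallyEq c v),
      cov.isCovariantDerivativeOnUniv.smul_const c (mdifferentiableAt_extend ..)]
    rfl

theorem frameEquiv_connectionForm_single (u : FrameBundle n M) (w : TangentSpace (frameModel n) u)
    (j : Fin n) :
    frameEquiv u ((connectionForm cov u w).mulVec (Pi.single j 1)) =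
      frameCovariantDifferential cov u j w := by
  rw [Matrix.mulVec_single_one]
  exact (frameEquiv u).apply_symm_apply (frameCovariantDifferential cov u j w)

/-- The connection map and the connection form are related by `K ((R_ξ)_* w) = u (ω(w) ξ)`. -/
theorem connectionMap_mfderiv_rightMul (ξ : Fin n → ℝ) (u : FrameBundle n M)
    (w : TangentSpace (frameModel n) u) :
    connectionMap cov (rightMul ξ u) (mfderiv (frameModel n) (𝓡 n).tangent (rightMul ξ) u w) =
      frameEquiv u ((connectionForm cov u w).mulVec ξ) := by
  let a : TangentSpace (𝓡 n) (frameProj u) :=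
    (w : EuclideanSpace ℝ (Fin n) × ((Fin n → ℝ) →L[ℝ] EuclideanSpace ℝ (Fin n))).1
  let b : (Fin n → ℝ) →ₗ[ℝ] TangentSpace (𝓡 n) (frameProj u) :=
    (w : EuclideanSpace ℝ (Fin n) × ((Fin n → ℝ) →L[ℝ] EuclideanSpace ℝ (Fin n))).2.toLinearMap
  let L : (Fin n → ℝ) →ₗ[ℝ] TangentSpace (𝓡 n) (frameProj u) :=
    b + christoffelMap cov a ∘ₗ (frameEquiv u).toLinearMap
  let R : (Fin n → ℝ) →ₗ[ℝ] TangentSpace (𝓡 n) (frameProj u) :=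
    (frameEquiv u).toLinearMap ∘ₗ (connectionForm cov u w).mulVecLin
  have hL : ∀ η : Fin n → ℝ, connectionMap cov (rightMul η u)
      (mfderiv (frameModel n) (𝓡 n).tangent (rightMul η) u w) = L η := by
    intro η
    unfold connectionMap
    rw [mfderiv_tangentProj, mfderiv_rightMul_parts]
    rfl
  -- Both sides are linear in `ξ`, so it is enough to compare them on the standard basis.
  have hLR : L = R := (Pi.basisFun ℝ (Fin n)).ext fun j => by
    rw [Pi.basisFun_apply, ← hL]
    exact (connectionMap_mfderiv_frameVector cov u j w).trans
      (frameEquiv_connectionForm_single cov u w j).symm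
  rw [hL, hLR]
  rfl

/-- The derivative form of `π_TM ∘ R_ξ = π`. -/
theorem mfderiv_tangentProj_rightMul (ξ : Fin n → ℝ) (u : FrameBundle n M)
    (w : TangentSpace (frameModel n) u) :
    mfderiv (𝓡 n).tangent (𝓡 n) (TotalSpace.proj : TangentBundle (𝓡 n) M → M) (rightMul ξ u)
      (mfderiv (frameModel n) (𝓡 n).tangent (rightMul ξ) u w) =
      mfderiv (frameModel n) (𝓡 n) frameProj u w := by
  rw [mfderiv_tangentProj, mfderiv_frameProj, mfderiv_rightMul_parts]
  rfl

theorem mfderiv_rightMul_mem_tangentHorizontal (ξ : Fin n → ℝ) {u : FrameBundle n M}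
    {w : TangentSpace (frameModel n) u} (hw : w ∈ frameHorizontal cov u) :
    mfderiv (frameModel n) (𝓡 n).tangent (rightMul ξ) u w ∈
      tangentHorizontal cov (rightMul ξ u) := by
  have h : connectionForm cov u w = 0 := hw
  refine (connectionMap_mfderiv_rightMul cov ξ u w).trans ?_
  rw [h, Matrix.zero_mulVec, map_zero]
  rfl

theorem mfderiv_rightMul_frameHorizontalLift (ξ : Fin n → ℝ)
    (X : Π x : M, TangentSpace (𝓡 n) x) (u : FrameBundle n M) :
    mfderiv (frameModel n) (𝓡 n).tangent (rightMul ξ) u (frameHorizontalLift cov X u) =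
      tangentHorizontalLift cov X (rightMul ξ u) := by
  have hu := (existsUnique_frameHorizontal cov u (X (frameProj u))).choose_spec.1
  refine (existsUnique_tangentHorizontal cov (rightMul ξ u) (X (frameProj u))).unique
    ⟨mfderiv_rightMul_mem_tangentHorizontal cov ξ hu.1, ?_⟩
    (existsUnique_tangentHorizontal cov (rightMul ξ u) (X (rightMul ξ u).proj)).choose_spec.1
  exact (mfderiv_tangentProj_rightMul ξ u _).trans hu.2

/-- Both horizontal spaces project isomorphically onto `T_x M`, compatibly with `(R_ξ)_*`. This
holds for every `ξ`, also for `ξ = 0`. -/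
theorem bijOn_mfderiv_rightMul_frameHorizontal (ξ : Fin n → ℝ) (u : FrameBundle n M) :
    Set.BijOn (mfderiv (frameModel n) (𝓡 n).tangent (rightMul ξ) u)
      (frameHorizontal cov u) (tangentHorizontal cov (rightMul ξ u)) := by
  refine ⟨fun w hw => mfderiv_rightMul_mem_tangentHorizontal cov ξ hw, ?_, ?_⟩
  · intro w hw w' hw' h
    refine (existsUnique_frameHorizontal cov u _).unique ⟨hw, rfl⟩ ⟨hw', ?_⟩
    rw [← mfderiv_tangentProj_rightMul ξ u w, h, mfderiv_tangentProj_rightMul]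
  · intro ζ hζ
    obtain ⟨w, hw, hwv⟩ := (existsUnique_frameHorizontal cov u
      (mfderiv (𝓡 n).tangent (𝓡 n) (TotalSpace.proj : TangentBundle (𝓡 n) M → M)
        (rightMul ξ u) ζ)).exists
    refine ⟨w, hw, (existsUnique_tangentHorizontal cov (rightMul ξ u) _).unique
      ⟨mfderiv_rightMul_mem_tangentHorizontal cov ξ hw, ?_⟩ ⟨hζ, rfl⟩⟩
    exact (mfderiv_tangentProj_rightMul ξ u w).trans hwv

end Connection

/-! ### Vertical distributions -/

theorem tangentFiberPart_mfderiv_frameVector (i : Fin n) (u : FrameBundle n M)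
    (w : TangentSpace (frameModel n) u) :
    tangentFiberPart (frameVector i u)
      (mfderiv (frameModel n) (𝓡 n).tangent (frameVector i) u w) = frameFiberPart u i w := by
  have h := mfderiv_rightMul_parts (Pi.single i 1) u w
  rw [frameVector, h]
  rfl

theorem tangentBundle_vector_ext {ζ : TangentBundle (𝓡 n) M} {ξ η : TangentSpace (𝓡 n).tangent ζ}
    (h₁ : mfderiv (𝓡 n).tangent (𝓡 n) (TotalSpace.proj : TangentBundle (𝓡 n) M → M) ζ ξ =
      mfderiv (𝓡 n).tangent (𝓡 n) (TotalSpace.proj : TangentBundle (𝓡 n) M → M) ζ η)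
    (h₂ : tangentFiberPart ζ ξ = tangentFiberPart ζ η) : ξ = η := by
  rw [mfderiv_tangentProj] at h₁
  exact Prod.ext h₁ h₂

/-- Every vertical vector is fundamental: its generator has as columns the components of the
columns of the vector in the frame `u`. -/
theorem eq_fundamentalVector_of_mem_frameVertical {u : FrameBundle n M}
    {w : TangentSpace (frameModel n) u} (hw : w ∈ frameVertical u) :
    w = fundamentalVector
      (Matrix.of fun k j => (frameEquiv u).symm (frameFiberPart u j w) k) u := by
  have hA := fundamentalVector_parts u
    (Matrix.of fun k j => (frameEquiv u).symm (frameFiberPart u j w) k)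
  refine frame_ext ((show mfderiv (frameModel n) (𝓡 n) frameProj u w = 0 from hw).trans hA.1.symm)
    fun j => ?_
  rw [hA.2 j]
  exact ((frameEquiv u).apply_symm_apply _).symm

/-- The space `V^i` consists of the vertical vectors whose columns other than the `i`-th one
vanish. -/
theorem mem_frameVerticalColumn_iff {i : Fin n} {u : FrameBundle n M}
    {w : TangentSpace (frameModel n) u} :
    w ∈ frameVerticalColumn i u ↔
      w ∈ frameVertical u ∧ ∀ j, j ≠ i → frameFiberPart u j w = 0 := by
  constructor
  · intro hw
    let S : Submodule ℝ (TangentSpace (frameModel n) u) := frameVertical u ⊓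
      ⨅ (j : Fin n) (_ : j ≠ i), LinearMap.ker (frameFiberPart u j).toLinearMap
    have hS : frameVerticalColumn i u ≤ S := by
      refine Submodule.span_le.2 ?_
      rintro _ ⟨A, hA, rfl⟩
      refine Submodule.mem_inf.2 ⟨(fundamentalVector_parts u A).1, ?_⟩
      simp only [Submodule.mem_iInf]
      intro j hj
      refine ((fundamentalVector_parts u A).2 j).trans ?_
      have h0 : (fun k => A k j) = 0 := funext fun k => hA k j hj
      rw [h0, map_zero]
    have h := Submodule.mem_inf.1 (hS hw)
    simp only [Submodule.mem_iInf] at h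
    exact ⟨h.1, fun j hj => h.2 j hj⟩
  · rintro ⟨hw, hj⟩
    refine Submodule.subset_span ⟨_, fun k j hji => ?_, eq_fundamentalVector_of_mem_frameVertical hw⟩
    rw [Matrix.of_apply, hj j hji, map_zero, Pi.zero_apply]

theorem exists_mem_frameVerticalColumn (i : Fin n) (u : FrameBundle n M)
    (b : TangentSpace (𝓡 n) (frameProj u)) :
    ∃ w ∈ frameVerticalColumn i u, frameFiberPart u i w = b := by
  classical
  obtain ⟨w, h1, h2⟩ := exists_frame_vector u 0 (Pi.single i b)
  refine ⟨w, mem_frameVerticalColumn_iff.2 ⟨h1, fun j hj => ?_⟩, ?_⟩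
  · rw [h2, Pi.single_eq_of_ne hj]
  · rw [h2, Pi.single_eq_same]

theorem mfderiv_frameVector_mem_tangentVertical (i : Fin n) {u : FrameBundle n M}
    {w : TangentSpace (frameModel n) u} (hw : w ∈ frameVertical u) :
    mfderiv (frameModel n) (𝓡 n).tangent (frameVector i) u w ∈
      tangentVertical (frameVector i u) :=
  (mfderiv_tangentProj_rightMul (Pi.single i 1) u w).trans hw

theorem bijOn_mfderiv_frameVector_frameVerticalColumn (i : Fin n) (u : FrameBundle n M) :
    Set.BijOn (mfderiv (frameModel n) (𝓡 n).tangent (frameVector i) u)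
      (frameVerticalColumn i u) (tangentVertical (frameVector i u)) := by
  refine ⟨fun w hw => mfderiv_frameVector_mem_tangentVertical i
    (mem_frameVerticalColumn_iff.1 hw).1, ?_, ?_⟩
  · intro w hw w' hw' h
    obtain ⟨hv, hc⟩ := mem_frameVerticalColumn_iff.1 hw
    obtain ⟨hv', hc'⟩ := mem_frameVerticalColumn_iff.1 hw'
    refine frame_ext (Eq.trans hv hv'.symm) fun j => ?_
    by_cases hj : j = i
    · subst hj
      rw [← tangentFiberPart_mfderiv_frameVector, h, tangentFiberPart_mfderiv_frameVector]
    · rw [hc j hj, hc' j hj]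
  · intro ζ hζ
    obtain ⟨w, hw, hb⟩ := exists_mem_frameVerticalColumn i u (tangentFiberPart (frameVector i u) ζ)
    refine ⟨w, hw, tangentBundle_vector_ext ?_ ?_⟩
    · exact Eq.trans (mfderiv_frameVector_mem_tangentVertical i
        (mem_frameVerticalColumn_iff.1 hw).1) (Eq.symm hζ)
    · exact (tangentFiberPart_mfderiv_frameVector i u w).trans hb

theorem mfderiv_frameVector_eq_zero {i j : Fin n} (hji : j ≠ i) {u : FrameBundle n M}
    {w : TangentSpace (frameModel n) u} (hw : w ∈ frameVerticalColumn j u) :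
    mfderiv (frameModel n) (𝓡 n).tangent (frameVector i) u w = 0 := by
  obtain ⟨hv, hc⟩ := mem_frameVerticalColumn_iff.1 hw
  refine tangentBundle_vector_ext ?_ ?_
  · rw [map_zero]
    exact mfderiv_frameVector_mem_tangentVertical i hv
  · rw [map_zero, tangentFiberPart_mfderiv_frameVector, hc i hji.symm]
    rfl

theorem frameVertical_eq_iSup_frameVerticalColumn (u : FrameBundle n M) :
    frameVertical u = ⨆ i, frameVerticalColumn i u := by
  refine le_antisymm (fun w hw => ?_)
    (iSup_le fun i w hw => (mem_frameVerticalColumn_iff.1 hw).1)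
  choose c hc hcb using fun i => exists_mem_frameVerticalColumn i u (frameFiberPart u i w)
  have hsum : w = ∑ i, c i := by
    refine frame_ext (Eq.trans hw ?_) fun j => ?_
    · have h : ∑ i, c i ∈ frameVertical u :=
        Submodule.sum_mem _ fun i _ => (mem_frameVerticalColumn_iff.1 (hc i)).1
      exact Eq.symm h
    · refine ((map_sum (frameFiberPart u j).toLinearMap c Finset.univ).trans ?_).symm
      refine (Finset.sum_eq_single j
        (fun i _ hij => (mem_frameVerticalColumn_iff.1 (hc i)).2 j hij.symm)
        fun h => absurd (Finset.mem_univ j) h).trans ?_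
      exact hcb j
  rw [hsum]
  exact Submodule.sum_mem _ fun i _ => Submodule.mem_iSup_of_mem i (hc i)

theorem iSupIndep_frameVerticalColumn (u : FrameBundle n M) :
    iSupIndep fun i => frameVerticalColumn i u := by
  intro i
  rw [Submodule.disjoint_def]
  intro w hw hw'
  have hle : ⨆ (j) (_ : j ≠ i), frameVerticalColumn j u ≤
      LinearMap.ker (frameFiberPart u i).toLinearMap :=
    iSup₂_le fun j hj w hw => (mem_frameVerticalColumn_iff.1 hw).2 i hj.symm
  obtain ⟨hv, hc⟩ := mem_frameVerticalColumn_iff.1 hw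
  refine frame_ext (Eq.trans hv (mfderiv (frameModel n) (𝓡 n) frameProj u).map_zero.symm) fun j =>
    Eq.trans ?_ (frameFiberPart u j).map_zero.symm
  by_cases hj : j = i
  · subst hj; exact hle hw'
  · exact hc j hj

end FrameBundleGeometry

end

theorem mainTheorem7 {n : ℕ} {M : Type*} [TopologicalSpace M]
    [ChartedSpace (EuclideanSpace ℝ (Fin n)) M] [IsManifold (𝓡 n) ∞ M]
    [RiemannianBundle (fun x : M => TangentSpace (𝓡 n) x)]
    [IsContMDiffRiemannianBundle (𝓡 n) ∞ (EuclideanSpace ℝ (Fin n))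
      (fun x : M => TangentSpace (𝓡 n) x)] :
    -- the derivative of `R_ξ` sends `X^h` to `X^{h,TM}`, for every `ξ ∈ ℝⁿ` (so for every `R_i`)
    (∀ (ξ : Fin n → ℝ) (X : Π x : M, TangentSpace (𝓡 n) x) (u : FrameBundle n M),
      mfderiv (frameModel n) (𝓡 n).tangent (rightMul ξ) u
          (frameHorizontalLift (leviCivita (𝓡 n) M) X u) =
        tangentHorizontalLift (leviCivita (𝓡 n) M) X (rightMul ξ u)) ∧
    -- the derivative of `R_i` is an isomorphism between the horizontal distributions
    (∀ (i : Fin n) (u : FrameBundle n M),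
      Set.BijOn (mfderiv (frameModel n) (𝓡 n).tangent (frameVector i) u)
        (frameHorizontal (leviCivita (𝓡 n) M) u)
        (tangentHorizontal (leviCivita (𝓡 n) M) (frameVector i u))) ∧
    -- it is an isomorphism of `V^i` onto the vertical distribution of `TM`
    (∀ (i : Fin n) (u : FrameBundle n M),
      Set.BijOn (mfderiv (frameModel n) (𝓡 n).tangent (frameVector i) u)
        (frameVerticalColumn i u) (tangentVertical (frameVector i u))) ∧
    -- it vanishes on `V^j` for `j ≠ i`
    (∀ (i j : Fin n), j ≠ i → ∀ (u : FrameBundle n M), ∀ w ∈ frameVerticalColumn j u,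
      mfderiv (frameModel n) (𝓡 n).tangent (frameVector i) u w = 0) ∧
    -- the vertical distribution of `L(M)` is the direct sum of `V^1, …, V^n`
    (∀ u : FrameBundle n M,
      frameVertical u = ⨆ i, frameVerticalColumn i u ∧
        iSupIndep fun i => frameVerticalColumn i u) :=
  ⟨fun ξ X u => mfderiv_rightMul_frameHorizontalLift _ ξ X u,
    fun i u => bijOn_mfderiv_rightMul_frameHorizontal _ (Pi.single i 1) u,
    bijOn_mfderiv_frameVector_frameVerticalColumn,
    fun _ _ hji _ _ hw => mfderiv_frameVector_eq_zero hji hw,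
    fun u => ⟨frameVertical_eq_iSup_frameVerticalColumn u, iSupIndep_frameVerticalColumn u⟩⟩
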